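/- **Setting.** For an integer $i\ge 2$ let $X_i$ be an alphabet with $i$ letters, $X_i^*$ the set of finite strings over $X_i$, $\lambda$ the empty string and $|x|_i$ the length of $x\in X_i^*$. A *machine* is a partial computable function $T$ from $X_2^*$ to $X_2^*$ whose domain is prefix-free, and $H_{T}(y)=\min\{|p|_2 : T(p)=y\}$ (with $\min\emptyset=\infty$) is the program-size complexity relative to $T$. Fix a universal machine $U$, that is, a machine such that for every machine $T$ there is a constant $c$ with $H_U(y)\le H_T(y)+c$ for all $y\in X_2^*$, and write $H_2=H_U$. Let $g:X_i^*\to X_2^*$ be a Gödel numbering, i.e. a computable one-to-one function, and put $\rho^1_g(x)=H_2(g(x))/|x|_i$ for $x\ne\lambda$ and $\rho^1_g(\lambda)=0$. For a function $\rho:X_i^*\to\mathbb Q$ consider the two conditions: (i) for every finitely-specified (i.e. with a computably enumerable set of axioms), arithmetically sound, consistent theory $\mathcal F$ strong enough to formalize arithmetic, with sentences written over $X_i$, there is an integer $N_{\mathcal F}$ such that $\rho(x)<N_{\mathcal F}$ whenever $\mathcal F\vdash x$; (ii) for every integer $N$, $\lim_{n\to\infty} i^{-n}\cdot\mathrm{card}\{x\in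 X_i^* : |x|_i=n \text{ and } \rho(x)\le N\}=0$. **Proposition.** For every $i\ge2$, every universal machine $U$ and every Gödel numbering $g:X_i^*\to X_2^*$, $H_2$ takes only finite values, and there is an integer $M$ (depending only on $i$, $U$ and $g$) such that $\rho^1_g(x)\le M$ for all $x\in X_i^*$, and such that for every integer $N\ge M$, $\lim_{n\to\infty} i^{-n}\cdot\mathrm{card}\{x\in X_i^* : |x|_i=n \text{ and } \rho^1_g(x)\le N\}=1$. In particular $\rho^1_g$ satisfies condition (i) and does not satisfy condition (ii). -/

import Mathlib

open Filter Topology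

/-! ## Self-delimiting machines and program-size complexity

`List (Fin i)` is the set of strings over the alphabet with `i` letters; the length of a string is
`List.length`. -/

/-- A self-delimiting machine: a partial computable string function with prefix-free domain. -/
structure IsMachine {i : ℕ} (T : List (Fin i) →. List (Fin i)) : Prop where
  partrec : Partrec T
  prefixFree : ∀ x y, (T x).Dom → (T y).Dom → x <+: y → x = y

/-- The program-size complexity of `x` relative to `T`: the least length of a program `y` with
`T(y) = x`, and `∞` if there is none. -/
noncomputable def progComplexity {i : ℕ} (T : List (Fin i) →. List (Fin i))
    (x : List (Fin i)) : ℕ∞ :=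
  ⨅ (y : List (Fin i)) (_ : x ∈ T y), (y.length : ℕ∞)

/-- A universal machine: a machine that minimizes the program-size complexity up to an additive
constant. -/
structure IsUniversalMachine {i : ℕ} (U : List (Fin i) →. List (Fin i)) : Prop where
  isMachine : IsMachine U
  minimizes : ∀ T : List (Fin i) →. List (Fin i), IsMachine T →
    ∃ c : ℕ, ∀ x, progComplexity U x ≤ progComplexity T x + c

/-- A Gödel numbering of the strings over the `i`-letter alphabet: a computable one-to-one map to
the binary strings. -/
structure IsGodelNumbering {i : ℕ} (g : List (Fin i) → List (Fin 2)) : Prop where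
  computable : Computable g
  injective : Function.Injective g

/-! ## First-order provability -/

namespace FirstOrder.Language

variable {L : FirstOrder.Language.{0, 0}}

/-- Rename the free variable `n` to `n + 1`. -/
def Formula.shift (φ : L.Formula ℕ) : L.Formula ℕ := φ.relabel Nat.succ

/-- Instantiate the outermost bound variable of the body `φ` of `∀' φ` by the term `t`. -/
def BoundedFormula.inst (φ : L.BoundedFormula ℕ 1) (t : L.Term ℕ) : L.Formula ℕ :=
  BoundedFormula.subst φ.toFormula (Sum.elim Term.var fun _ => t)

/-- Instantiate the outermost bound variable of `φ` by the variable `0`, all other free variables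
being shifted by one: `0` is fresh. -/
def BoundedFormula.openFresh (φ : L.BoundedFormula ℕ 1) : L.Formula ℕ :=
  BoundedFormula.subst φ.toFormula (Sum.elim (fun n => Term.var (n + 1)) fun _ => Term.var 0)

/-- Natural deduction for classical first-order logic with equality, on formulas with free
variables in `ℕ`. -/
inductive Proves : Set (L.Formula ℕ) → L.Formula ℕ → Prop
  | hyp {Γ : Set (L.Formula ℕ)} {φ : L.Formula ℕ} : φ ∈ Γ → Proves Γ φ
  | impIntro {Γ : Set (L.Formula ℕ)} {φ ψ : L.Formula ℕ} :
      Proves (insert φ Γ) ψ → Proves Γ (φ.imp ψ)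
  | impElim {Γ : Set (L.Formula ℕ)} {φ ψ : L.Formula ℕ} :
      Proves Γ (φ.imp ψ) → Proves Γ φ → Proves Γ ψ
  | byContra {Γ : Set (L.Formula ℕ)} {φ : L.Formula ℕ} :
      Proves (insert (Formula.not φ) Γ) (⊥ : L.BoundedFormula ℕ 0) → Proves Γ φ
  | allIntro {Γ : Set (L.Formula ℕ)} {φ : L.BoundedFormula ℕ 1} :
      Proves (Formula.shift '' Γ) φ.openFresh → Proves Γ φ.all
  | allElim {Γ : Set (L.Formula ℕ)} {φ : L.BoundedFormula ℕ 1} (t : L.Term ℕ) :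
      Proves Γ φ.all → Proves Γ (φ.inst t)
  | eqRefl {Γ : Set (L.Formula ℕ)} (t : L.Term ℕ) : Proves Γ (t.equal t)
  | eqSubst {Γ : Set (L.Formula ℕ)} (φ : L.BoundedFormula ℕ 1) (s t : L.Term ℕ) :
      Proves Γ (s.equal t) → Proves Γ (φ.inst s) → Proves Γ (φ.inst t)

/-- A sentence, regarded as a formula with free variables in `ℕ`. -/
def Sentence.toFormulaNat (φ : L.Sentence) : L.Formula ℕ := Formula.relabel Empty.elim φ

/-- The set `A` of sentences proves the sentence `φ`. -/
def Theory.ProvesSentence (A : L.Theory) (φ : L.Sentence) : Prop :=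
  Proves (Sentence.toFormulaNat '' A) φ.toFormulaNat

/-- The standard code number of a sentence, from a numbering of the symbols. -/
def Sentence.code [Encodable (Σ n, L.Functions n)] [Encodable (Σ n, L.Relations n)]
    (φ : L.Sentence) : ℕ :=
  Encodable.encode (BoundedFormula.listEncode φ)

end FirstOrder.Language

/-! ## First-order arithmetic -/

namespace Arithmetic

open FirstOrder FirstOrder.Language

/-- The function symbols of arithmetic: zero, successor, addition, multiplication. -/
inductive ArithFunc : ℕ → Type
  | zero : ArithFunc 0
  | succ : ArithFunc 1
  | add : ArithFunc 2
  | mul : ArithFunc 2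

/-- The language of first-order arithmetic. -/
def arith : FirstOrder.Language.{0, 0} := ⟨ArithFunc, fun _ => Empty⟩

/-- The numbering of the symbols of arithmetic. -/
def arithFuncEquiv : (Σ n, arith.Functions n) ≃ Fin 4 where
  toFun
    | ⟨_, ArithFunc.zero⟩ => 0
    | ⟨_, ArithFunc.succ⟩ => 1
    | ⟨_, ArithFunc.add⟩ => 2
    | ⟨_, ArithFunc.mul⟩ => 3
  invFun
    | 0 => ⟨0, ArithFunc.zero⟩
    | 1 => ⟨1, ArithFunc.succ⟩
    | 2 => ⟨2, ArithFunc.add⟩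
    | 3 => ⟨2, ArithFunc.mul⟩
  left_inv := by rintro ⟨_, _ | _ | _ | _⟩ <;> rfl
  right_inv := by intro k; fin_cases k <;> rfl

instance : Encodable (Σ n, arith.Functions n) := Encodable.ofEquiv _ arithFuncEquiv

instance (n : ℕ) : IsEmpty (arith.Relations n) := inferInstanceAs (IsEmpty Empty)

instance : IsEmpty (Σ n, arith.Relations n) := ⟨fun s => isEmptyElim s.2⟩

instance : Encodable (Σ n, arith.Relations n) := IsEmpty.toEncodable

/-- The standard model of arithmetic. -/
instance : arith.Structure ℕ where
  funMap
    | ArithFunc.zero, _ => 0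
    | ArithFunc.succ, v => v 0 + 1
    | ArithFunc.add, v => v 0 + v 1
    | ArithFunc.mul, v => v 0 * v 1
  RelMap R _ := Empty.elim R

variable {α : Type}

/-- The term `0`. -/
def zeroT : arith.Term α := Term.func (l := 0) ArithFunc.zero ![]

/-- The term `S t`. -/
def succT (t : arith.Term α) : arith.Term α := Term.func (l := 1) ArithFunc.succ ![t]

/-- The term `s + t`. -/
def addT (s t : arith.Term α) : arith.Term α := Term.func (l := 2) ArithFunc.add ![s, t]

/-- The term `s · t`. -/
def mulT (s t : arith.Term α) : arith.Term α := Term.func (l := 2) ArithFunc.mul ![s, t]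

/-- Robinson arithmetic: the seven axioms
`S x ≠ 0`, `S x = S y → x = y`, `x ≠ 0 → ∃ y, x = S y`, `x + 0 = x`, `x + S y = S (x + y)`,
`x · 0 = 0`, `x · S y = x · y + x`. -/
def robinson : arith.Theory :=
  { ∀' ∼(succT (&0) =' zeroT),
    ∀' ∀' ((succT (&0) =' succT (&1)) ⟹ (&0 =' &1)),
    ∀' (∼(&0 =' zeroT) ⟹ ∃' (&0 =' succT (&1))),
    ∀' (addT (&0) zeroT =' &0),
    ∀' ∀' (addT (&0) (succT (&1)) =' succT (addT (&0) (&1))),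
    ∀' (mulT (&0) zeroT =' zeroT),
    ∀' ∀' (mulT (&0) (succT (&1)) =' addT (mulT (&0) (&1)) (&0)) }

end Arithmetic

/-! ## Theories that satisfy the hypotheses of Gödel's incompleteness theorem -/

open FirstOrder FirstOrder.Language Arithmetic in
/-- A finitely-specified, arithmetically sound, consistent theory strong enough to formalize
arithmetic, whose sentences are written over the alphabet with `i` letters. The theory need not be
in the language of arithmetic (it may be a set theory, say): arithmetic is formalized in it through
an effective translation of arithmetical sentences (for instance the identity of `arith`). -/
structure GodelTheory (i : ℕ) where
  /-- the language -/
  lang : FirstOrder.Language.{0, 0}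
  /-- the symbols are effectively numbered -/
  [primcodableFunctions : Primcodable (Σ n, lang.Functions n)]
  [primcodableRelations : Primcodable (Σ n, lang.Relations n)]
  /-- the arity of a symbol is computable -/
  computable_arity_functions : Computable fun s : Σ n, lang.Functions n => s.1
  computable_arity_relations : Computable fun s : Σ n, lang.Relations n => s.1
  /-- the string by which a sentence is written -/
  write : lang.Sentence → List (Fin i)
  write_injective : Function.Injective write
  /-- sentences are written effectively -/
  write_computable : ∃ e : ℕ →. List (Fin i), Partrec e ∧ ∀ φ, write φ ∈ e φ.code
  /-- the axioms -/
  axiomSet : lang.Theory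
  /-- finitely specified: the set of axioms is computably enumerable -/
  axiomSet_re : REPred fun s : List (Fin i) => ∃ φ ∈ axiomSet, write φ = s
  /-- consistent -/
  consistent : ¬ axiomSet.ProvesSentence (⊥ : lang.BoundedFormula Empty 0)
  /-- the translation of arithmetical sentences -/
  translate : arith.Sentence → lang.Sentence
  translate_computable : ∃ e : ℕ →. ℕ, Partrec e ∧ ∀ φ, (translate φ).code ∈ e φ.code
  translate_falsum : translate (⊥ : arith.BoundedFormula Empty 0) =
    (⊥ : lang.BoundedFormula Empty 0)
  translate_imp : ∀ φ ψ : arith.Sentence,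
    translate (φ.imp ψ) = (translate φ).imp (translate ψ)
  /-- the arithmetical theorems are closed under provability -/
  translate_closed : ∀ φ : arith.Sentence,
    Theory.ProvesSentence {ψ | axiomSet.ProvesSentence (translate ψ)} φ →
      axiomSet.ProvesSentence (translate φ)
  /-- strong enough to formalize arithmetic: the axioms of Robinson arithmetic are provable -/
  strong : ∀ φ ∈ robinson, axiomSet.ProvesSentence (translate φ)
  /-- arithmetically sound: every provable arithmetical sentence is true -/
  sound : ∀ φ : arith.Sentence, axiomSet.ProvesSentence (translate φ) → ℕ ⊨ φ

/-- `F ⊢ x` for a string `x`: it is the written form of a sentence that `F` proves. -/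
def GodelTheory.Proves {i : ℕ} (F : GodelTheory i) (x : List (Fin i)) : Prop :=
  ∃ φ : F.lang.Sentence, F.write φ = x ∧ F.axiomSet.ProvesSentence φ

/-! ## Complexity measures -/

/-- The measure `u ↦ rhoHat (H₂(g(u))) |u|` that the builder with witness `rhoHat` attaches to the
Gödel numbering `g`; here `H₂` is the complexity relative to `U`, which is finite for universal
`U`. -/
noncomputable def builder {i : ℕ} (rhoHat : ℕ → ℕ → ℚ) (U : List (Fin 2) →. List (Fin 2))
    (g : List (Fin i) → List (Fin 2)) (u : List (Fin i)) : ℚ :=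
  rhoHat (progComplexity U (g u)).toNat u.length

/-- The witness `x / y` if `y ≠ 0`, and `0` otherwise. -/
def rhoHat1 (x y : ℕ) : ℚ := if y ≠ 0 then (x : ℚ) / (y : ℚ) else 0

/-- The measure `x ↦ H₂(g(x)) / |x|` (`0` at the empty string). -/
noncomputable def rho1 {i : ℕ} (U : List (Fin 2) →. List (Fin 2))
    (g : List (Fin i) → List (Fin 2)) : List (Fin i) → ℚ :=
  builder rhoHat1 U g

/-- Condition (i): on the theorems of any theory the measure is bounded. -/
def BoundCondition {i : ℕ} (rho : List (Fin i) → ℚ) : Prop :=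
  ∀ F : GodelTheory i, ∃ N : ℤ, ∀ x, F.Proves x → rho x < N

/-- The proportion `i⁻ⁿ · card {x | |x| = n and rho x ≤ N}`. -/
noncomputable def density {i : ℕ} (rho : List (Fin i) → ℚ) (N : ℤ) (n : ℕ) : ℝ :=
  (i : ℝ) ^ (-(n : ℤ)) * (Set.ncard {x : List (Fin i) | x.length = n ∧ rho x ≤ N} : ℝ)

/-- Condition (ii): for every integer `N` the proportion of strings of length `n` of measure at
most `N` tends to `0`. -/
def LimCondition {i : ℕ} (rho : List (Fin i) → ℚ) : Prop :=
  ∀ N : ℤ, Tendsto (density rho N) atTop (𝓝 0)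

/-- The binary block of a letter: a leading `1`, then the indicator word of the letter. -/
def letterBlock {i : ℕ} (a : Fin i) : List (Fin 2) :=
  1 :: List.ofFn fun j : Fin i => if j = a then 1 else 0

theorem length_letterBlock {i : ℕ} (a : Fin i) : (letterBlock a).length = i + 1 := by
  simp [letterBlock]

theorem letterBlock_injective {i : ℕ} : Function.Injective (letterBlock (i := i)) := by
  intro a b h
  have h' := congrFun (List.ofFn_injective (List.cons.inj h).2) a
  by_contra hab
  simp [hab] at h'

/-- A self-delimiting binary code of the strings over the alphabet with `i` letters. -/
def selfDelimit {i : ℕ} (x : List (Fin i)) : List (Fin 2) :=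
  x.flatMap letterBlock ++ [0]

theorem selfDelimit_nil {i : ℕ} : selfDelimit ([] : List (Fin i)) = [0] := rfl

theorem selfDelimit_cons {i : ℕ} (a : Fin i) (x : List (Fin i)) :
    selfDelimit (a :: x) = letterBlock a ++ selfDelimit x := by
  simp [selfDelimit]

theorem length_selfDelimit {i : ℕ} (x : List (Fin i)) :
    (selfDelimit x).length = x.length * (i + 1) + 1 := by
  induction x with
  | nil => simp [selfDelimit_nil]
  | cons a x ih =>
    rw [selfDelimit_cons, List.length_append, ih, length_letterBlock, List.length_cons]
    ring

theorem selfDelimit_prefixFree {i : ℕ} :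
    ∀ x y : List (Fin i), selfDelimit x <+: selfDelimit y → x = y
  | [], [], _ => rfl
  | [], b :: y, h => by
    rw [selfDelimit_cons, selfDelimit_nil, letterBlock, List.cons_append,
      List.cons_prefix_cons] at h
    exact absurd h.1 (by decide)
  | a :: x, [], h => by
    rw [selfDelimit_cons, selfDelimit_nil, letterBlock, List.cons_append,
      List.cons_prefix_cons] at h
    exact absurd h.1 (by decide)
  | a :: x, b :: y, h => by
    rw [selfDelimit_cons, selfDelimit_cons] at h
    obtain ⟨t, ht⟩ := h
    rw [List.append_assoc] at ht
    obtain ⟨hab, hxy⟩ := List.append_inj ht (by simp only [length_letterBlock])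
    rw [letterBlock_injective hab, selfDelimit_prefixFree x y ⟨t, hxy⟩]

theorem computable_selfDelimit {i : ℕ} : Computable (selfDelimit (i := i)) :=
  (Primrec.list_append.comp
    (Primrec.list_flatMap Primrec.id ((Primrec.dom_finite letterBlock).comp Primrec.snd).to₂)
    (Primrec.const [0])).to_comp

/-- The output of the decoding machine at stage `n`: `h x` if `n` is the number of a string `x`
with code `p`. -/
def decodeStage {i : ℕ} (h : List (Fin i) → List (Fin 2)) (p : List (Fin 2)) (n : ℕ) :
    Option (List (Fin 2)) :=
  (Encodable.decode (α := List (Fin i)) n).bind fun x =>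
    bif decide (selfDelimit x = p) then some (h x) else none

theorem mem_decodeStage {i : ℕ} {h : List (Fin i) → List (Fin 2)} {p y : List (Fin 2)} {n : ℕ} :
    y ∈ decodeStage h p n ↔
      ∃ x, Encodable.decode (α := List (Fin i)) n = some x ∧ selfDelimit x = p ∧ h x = y := by
  simp only [decodeStage, Option.mem_def, Option.bind_eq_some_iff]
  refine exists_congr fun x => and_congr_right fun _ => ?_
  by_cases hx : selfDelimit x = p
  · simp [hx]
  · simp [hx]

theorem computable_decodeStage {i : ℕ} {h : List (Fin i) → List (Fin 2)} (hh : Computable h) :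
    Computable₂ (decodeStage h) := by
  have hbeq : Computable fun q : (List (Fin 2) × ℕ) × List (Fin i) =>
      decide (selfDelimit q.2 = q.1.1) :=
    Primrec.eq.decide.to_comp.comp (computable_selfDelimit.comp Computable.snd)
      (Computable.fst.comp Computable.fst)
  have hcond : Computable₂ fun (q : List (Fin 2) × ℕ) (x : List (Fin i)) =>
      bif decide (selfDelimit x = q.1) then some (h x) else none :=
    Computable.cond hbeq (Computable.option_some.comp (hh.comp Computable.snd))
      (Computable.const none)
  have hdecode : Computable fun q : List (Fin 2) × ℕ =>
      Encodable.decode (α := List (Fin i)) q.2 :=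
    Computable.decode.comp Computable.snd
  exact Computable.option_bind hdecode hcond

/-- The machine that sends the code of `x` to `h x`. -/
def decodingMachine {i : ℕ} (h : List (Fin i) → List (Fin 2)) :
    List (Fin 2) →. List (Fin 2) :=
  fun p => Nat.rfindOpt (decodeStage h p)

theorem mem_decodingMachine {i : ℕ} {h : List (Fin i) → List (Fin 2)} {p y : List (Fin 2)}
    (hy : y ∈ decodingMachine h p) : ∃ x, selfDelimit x = p ∧ h x = y := by
  obtain ⟨n, hn⟩ := Nat.rfindOpt_spec hy
  obtain ⟨x, -, hx⟩ := mem_decodeStage.1 hn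
  exact ⟨x, hx⟩

theorem apply_mem_decodingMachine {i : ℕ} (h : List (Fin i) → List (Fin 2)) (x : List (Fin i)) :
    h x ∈ decodingMachine h (selfDelimit x) := by
  have hdom : (decodingMachine h (selfDelimit x)).Dom :=
    Nat.rfindOpt_dom.2 ⟨Encodable.encode x, h x,
      mem_decodeStage.2 ⟨x, Encodable.encodek x, rfl, rfl⟩⟩
  obtain ⟨x', hx', hy⟩ := mem_decodingMachine (Part.get_mem hdom)
  have : x' = x := selfDelimit_prefixFree _ _ (hx' ▸ List.prefix_rfl)
  rw [← this, hy, this]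
  exact Part.get_mem hdom

theorem isMachine_decodingMachine {i : ℕ} {h : List (Fin i) → List (Fin 2)} (hh : Computable h) :
    IsMachine (decodingMachine h) where
  partrec := Partrec.rfindOpt (computable_decodeStage hh)
  prefixFree := by
    intro p q hp hq hpq
    obtain ⟨x, rfl, -⟩ := mem_decodingMachine (Part.get_mem hp)
    obtain ⟨y, rfl, -⟩ := mem_decodingMachine (Part.get_mem hq)
    rw [selfDelimit_prefixFree x y hpq]

/-- The complexity of the value of a computable function is at most linear in the length of the
argument. -/
theorem IsUniversalMachine.progComplexity_le {U : List (Fin 2) →. List (Fin 2)}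
    (hU : IsUniversalMachine U) {i : ℕ} {h : List (Fin i) → List (Fin 2)} (hh : Computable h) :
    ∃ c : ℕ, ∀ x, progComplexity U (h x) ≤ (x.length * (i + 1) + c : ℕ) := by
  obtain ⟨c, hc⟩ := hU.minimizes _ (isMachine_decodingMachine hh)
  refine ⟨1 + c, fun x => (hc (h x)).trans ?_⟩
  have hle : progComplexity (decodingMachine h) (h x) ≤ ((selfDelimit x).length : ℕ∞) :=
    iInf₂_le (selfDelimit x) (apply_mem_decodingMachine h x)
  rw [length_selfDelimit] at hle
  rw [← add_assoc, Nat.cast_add _ c]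
  gcongr

theorem IsUniversalMachine.progComplexity_ne_top {U : List (Fin 2) →. List (Fin 2)}
    (hU : IsUniversalMachine U) (y : List (Fin 2)) : progComplexity U y ≠ ⊤ := by
  obtain ⟨c, hc⟩ := hU.progComplexity_le (Computable.id (α := List (Fin 2)))
  exact ne_top_of_le_ne_top (ENat.natCast_ne_top _) (hc y)

theorem IsUniversalMachine.exists_rho1_le {U : List (Fin 2) →. List (Fin 2)}
    (hU : IsUniversalMachine U) {i : ℕ} {g : List (Fin i) → List (Fin 2)} (hg : Computable g) :
    ∃ M : ℤ, ∀ x, rho1 U g x ≤ M := by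
  obtain ⟨c, hc⟩ := hU.progComplexity_le hg
  refine ⟨((i + 1 + c : ℕ) : ℤ), fun x => ?_⟩
  rw [rho1, builder, rhoHat1]
  split_ifs with hx
  · have hpos : 0 < x.length := Nat.pos_of_ne_zero hx
    rw [div_le_iff₀ (by exact_mod_cast hpos)]
    have hle : (progComplexity U (g x)).toNat ≤ x.length * (i + 1) + c :=
      ENat.toNat_le_of_le_natCast (hc x)
    have : (progComplexity U (g x)).toNat ≤ (i + 1 + c) * x.length := by nlinarith
    exact_mod_cast this
  · positivity

theorem ncard_length_eq (i n : ℕ) : Set.ncard {x : List (Fin i) | x.length = n} = i ^ n := by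
  have := card_vector (α := Fin i) n
  rw [Fintype.card_fin, ← Nat.card_eq_fintype_card] at this
  exact this

theorem density_eq_one {i : ℕ} (hi : i ≠ 0) {rho : List (Fin i) → ℚ} {N : ℤ}
    (h : ∀ x, rho x ≤ N) (n : ℕ) : density rho N n = 1 := by
  have hset : {x : List (Fin i) | x.length = n ∧ rho x ≤ N} = {x | x.length = n} := by
    ext x
    simp [h x]
  rw [density, hset, ncard_length_eq, Nat.cast_pow, zpow_neg, zpow_natCast]
  exact inv_mul_cancel₀ (pow_ne_zero _ (Nat.cast_ne_zero.2 hi))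

theorem mainTheorem4 (i : ℕ) (hi : 2 ≤ i)
    (U : List (Fin 2) →. List (Fin 2)) (hU : IsUniversalMachine U)
    (g : List (Fin i) → List (Fin 2)) (hg : IsGodelNumbering g) :
    (∀ y : List (Fin 2), progComplexity U y ≠ ⊤) ∧
    (∃ M : ℤ, (∀ x : List (Fin i), rho1 U g x ≤ M) ∧
      ∀ N : ℤ, M ≤ N → Tendsto (density (rho1 U g) N) atTop (𝓝 1)) ∧
    BoundCondition (rho1 U g) ∧
    ¬ LimCondition (rho1 U g) := by
  obtain ⟨M, hM⟩ := hU.exists_rho1_le hg.computable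
  have hlim : ∀ N : ℤ, M ≤ N → Tendsto (density (rho1 U g) N) atTop (𝓝 1) := by
    intro N hN
    have hN' : ∀ x, rho1 U g x ≤ N := fun x => (hM x).trans (by exact_mod_cast hN)
    exact tendsto_const_nhds.congr fun n => (density_eq_one (by omega) hN' n).symm
  refine ⟨hU.progComplexity_ne_top, ⟨M, hM, hlim⟩, fun F => ⟨M + 1, fun x _ => ?_⟩, fun h => ?_⟩
  · exact (hM x).trans_lt (by push_cast; exact lt_add_one _)
  · exact zero_ne_one (tendsto_nhds_unique (h M) (hlim M le_rfl))
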